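/- Let $\Sigma$ be a finite alphabet with at least two symbols. For a tree $T$ on the vertex set $\{1,\dots,n\}$, a distribution $P$ of $X=(X_1,\dots,X_n)$ on $\Sigma^n$ is called $T$-structured if, for a rooted orientation of $T$ with root $r$ and parent map $\mathrm{pa}$, it factorizes as $$P(x)=\Pr[X_r=x_r]\prod_{i\neq r}\Pr[X_i=x_i\mid X_{\mathrm{pa}(i)}=x_{\mathrm{pa}(i)}],$$ and tree-structured if it is $T$-structured for some tree $T$. Write $D(P\,\|\,Q)=\sum_x P(x)\log\frac{P(x)}{Q(x)}$ (natural logarithm, $+\infty$ if some $x$ has $P(x)>0=Q(x)$). A tree $T$ is an $\varepsilon$-approximate tree for $P$ if there is a $T$-structured distribution $Q$ with $$D(P\,\|\,Q)\le \varepsilon+\min_{\text{tree }T'}\ \min_{Q'\ T'\text{-structured}} D(P\,\|\,Q').$$ **Theorem.** The sample complexity of computing an $\varepsilon$-approximate tree for a tree-structured distribution on $n$ variables with error probability less than $1/3$ is $\Omega\!\left(n\varepsilon^{-1}\log\frac n\varepsilon\right)$. Precisely, there are absolute constants $c,\eta>0$ such that the following holds for every such $\Sigma$, every $n\ge 3$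 and every $0<\varepsilon\le \eta n$. Suppose a (possibly randomized) algorithm receives $N$ independent samples from an unknown distribution $P$ on $\Sigma^n$, outputs a tree on $\{1,\dots,n\}$, and, for every tree-structured $P$, its output fails to be an $\varepsilon$-approximate tree for $P$ with probability less than $1/3$. Then $$N\ \ge\ c\,\frac n\varepsilon\,\log\frac n\varepsilon .$$ -/

import Mathlib

open scoped ENNReal

namespace TreeLearning

noncomputable section

/-- Kullback–Leibler divergence (in nats, with value `∞` when `P` is not absolutely continuous
with respect to `Q`) of two discrete distributions, viewed as measures on the discrete
measurable space. -/
def kl {Ω : Type*} (P Q : PMF Ω) : ℝ≥0∞ :=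
  letI : MeasurableSpace Ω := ⊤
  InformationTheory.klDiv P.toMeasure Q.toMeasure

/-- The map `pa` sends every vertex other than the root `r` to its parent in the orientation of
the tree `T` away from `r`: the neighbour that is one step closer to `r`. (The value `pa r` is
irrelevant.) -/
def IsParentMap {V : Type*} (T : SimpleGraph V) (r : V) (pa : V → V) : Prop :=
  ∀ i, i ≠ r → T.Adj i (pa i) ∧ T.dist r i = T.dist r (pa i) + 1

/-- A distribution `P` of `(X_1, …, X_n)` on `Aⁿ` is `T`-structured: for a rooted orientation of
`T`, it factorizes as `P(x) = Pr[X_r = x_r] · ∏_{i ≠ r} Pr[X_i = x_i ∣ X_{pa(i)} = x_{pa(i)}]`.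
Here `ρ` is the law of the root variable, and `κ i a` is the law of `X_i` given
`X_{pa(i)} = a` (which may be any law if `X_{pa(i)} = a` has probability zero). -/
def IsStructured {A : Type*} {n : ℕ} (T : SimpleGraph (Fin n)) (P : PMF (Fin n → A)) : Prop :=
  ∃ (r : Fin n) (pa : Fin n → Fin n) (ρ : PMF A) (κ : Fin n → A → PMF A),
    IsParentMap T r pa ∧
      ∀ x : Fin n → A, P x = ρ (x r) * ∏ i ∈ Finset.univ.erase r, κ i (x (pa i)) (x i)

/-- `P` is tree-structured if it is `T`-structured for some tree `T` on the `n` coordinates. -/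
def IsTreeStructured {A : Type*} {n : ℕ} (P : PMF (Fin n → A)) : Prop :=
  ∃ T : SimpleGraph (Fin n), T.IsTree ∧ IsStructured T P

/-- The least divergence `D(P ‖ Q')` over all tree-structured distributions `Q'`. -/
def bestTreeDivergence {A : Type*} {n : ℕ} (P : PMF (Fin n → A)) : ℝ≥0∞ :=
  ⨅ (T : SimpleGraph (Fin n)) (_ : T.IsTree) (Q : PMF (Fin n → A)) (_ : IsStructured T Q), kl P Q

/-- `T` is an `ε`-approximate tree for `P`. -/
def IsApproxTree {A : Type*} {n : ℕ} (ε : ℝ) (P : PMF (Fin n → A)) (T : SimpleGraph (Fin n)) :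
    Prop :=
  T.IsTree ∧ ∃ Q : PMF (Fin n → A), IsStructured T Q ∧
    kl P Q ≤ ENNReal.ofReal ε + bestTreeDivergence P

/-- The joint law of `N` independent samples from `P`. -/
def iidSamples {Ω : Type*} [Fintype Ω] (P : PMF Ω) (N : ℕ) : PMF (Fin N → Ω) :=
  PMF.ofFintype (fun s => ∏ j, P (s j)) (by
    classical
    have h : ∑ a, P a = 1 := by rw [← tsum_fintype (L := .unconditional _)]; exact P.tsum_coe
    rw [← Fintype.piFinset_univ, ← Finset.prod_univ_sum]
    simp [h])

/-- A randomized algorithm that reads `N` samples from `Aⁿ` and outputs a tree on `n` vertices,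
described by the law of its output on every possible sequence of samples. -/
abbrev TreeAlgorithm (A : Type*) (n N : ℕ) : Type _ :=
  (Fin N → (Fin n → A)) → PMF {T : SimpleGraph (Fin n) // T.IsTree}

/-- The probability, over `N` independent samples from `P` and the internal randomness of the
algorithm, that the output is not an `ε`-approximate tree for `P`. -/
def errorProb {A : Type*} [Fintype A] {n N : ℕ} (alg : TreeAlgorithm A n N) (ε : ℝ)
    (P : PMF (Fin n → A)) : ℝ≥0∞ :=
  ((iidSamples P N).bind alg).toOuterMeasure {T | ¬ IsApproxTree ε P T.1}

end

end TreeLearning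

namespace TreeLearning

open Finset

/-! The bound comes from distributions that look constant in most samples. Take a uniform bit and
`|K|` copies of it, each flipped independently with probability `δ`, and let every variable repeat
one of these hidden bits, chosen by a labelling `θ`. Such a `model` is tree-structured, and with
probability `(1 - δ) ^ |K|` all hidden bits agree, in which case the sample says nothing about `θ`.

If `Q` is `T`-structured, comparing the entropy of the model with its cross entropy relative to `Q`
(`sum_binEntropy_le_of_kl_le`) gives `D(P ‖ Q) ≥ ∑ h(flip probability of the edge) - |K| h(δ)`, the
sum being over the edges of `T` and `h` the binary entropy. An edge joining different hidden bits
thus costs at least about `δ log (1/δ)`, whereas informative samples occur only at rate about `δ`;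
this mismatch produces the logarithm.

For `n ≥ 4` two hidden bits suffice: at least half of all labellings separate the ends of at least
half of the edges of `T` (`exists_bad_labellings`), and the excess is at least `(n - 3) / 2 * h(δ)`.
For `n = 3` this vanishes, so three stars are used instead; a tree is wrong for at least two of
their three centres (`exists_bad_stars`).

Averaging the error over the family (`pow_le_of_average_error`, `card_mul_samples_ge`) forces `(1 -
δ) ^ (|K| N) ≤ 2/3`, hence `|K| N δ ≥ 1/3`. Choosing `δ = 64 / (y log y)` with `y = n/ε` makes the
excess larger than `ε`. -/

/-! ### Divergence on finite spaces -/

theorem kl_lower_bound {Ω : Type*} [Fintype Ω] (P Q : PMF Ω) {ε : ℝ} (hε : 0 ≤ ε)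
    (h : kl P Q ≤ ENNReal.ofReal ε) :
    (∀ x, P x ≠ 0 → Q x ≠ 0) ∧
      ∑ x, (P x).toReal * Real.log ((P x).toReal / (Q x).toReal) ≤ ε := by
  let mΩ : MeasurableSpace Ω := ⊤
  have : DiscreteMeasurableSpace Ω := ⟨fun _ => trivial⟩
  have hk : InformationTheory.klDiv P.toMeasure Q.toMeasure ≤ ENNReal.ofReal ε := h
  have hne : InformationTheory.klDiv P.toMeasure Q.toMeasure ≠ ∞ :=
    (hk.trans_lt ENNReal.ofReal_lt_top).ne
  obtain ⟨hac, hint⟩ := InformationTheory.klDiv_ne_top_iff.1 hne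
  have hPs : ∀ (R : PMF Ω) x, R.toMeasure {x} = R x := fun R x =>
    R.toMeasure_apply_singleton x (measurableSet_singleton x)
  have hsupp : ∀ x, P x ≠ 0 → Q x ≠ 0 := fun x hx hq => hx <| by
    rw [← hPs P]; exact hac (by rw [hPs, hq])
  refine ⟨hsupp, ?_⟩
  have hto := InformationTheory.toReal_klDiv_of_measure_eq hac (by simp)
  have hle : (InformationTheory.klDiv P.toMeasure Q.toMeasure).toReal ≤ ε := by
    have := ENNReal.toReal_mono ENNReal.ofReal_ne_top hk
    rwa [ENNReal.toReal_ofReal hε] at this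
  rw [hto, MeasureTheory.integral_fintype hint] at hle
  refine le_trans (le_of_eq ?_) hle
  refine Finset.sum_congr rfl fun x _ => ?_
  rw [MeasureTheory.measureReal_def, hPs, smul_eq_mul]
  by_cases hx : P x = 0
  · simp [hx]
  congr 1
  rw [MeasureTheory.llr]
  -- Integrating the density over a singleton identifies it with the ratio of the two masses.
  have h1 : P.toMeasure {x} = P.toMeasure.rnDeriv Q.toMeasure x * Q x := by
    have := MeasureTheory.Measure.setLIntegral_rnDeriv hac {x}
    rw [MeasureTheory.lintegral_singleton, hPs Q] at this
    exact this.symm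
  rw [hPs] at h1
  rw [h1, ENNReal.toReal_mul, mul_div_assoc, div_self, mul_one]
  exact (ENNReal.toReal_pos (hsupp x hx) (Q.apply_ne_top x)).ne'

theorem kl_self {Ω : Type*} (P : PMF Ω) : kl P P = 0 := by
  let mΩ : MeasurableSpace Ω := ⊤
  exact InformationTheory.klDiv_self _

theorem bestTreeDivergence_eq_zero {A : Type*} {n : ℕ} {P : PMF (Fin n → A)}
    (hP : IsTreeStructured P) : bestTreeDivergence P = 0 := by
  obtain ⟨T, hT, hs⟩ := hP
  refine le_antisymm ?_ zero_le
  exact (iInf₂_le_of_le T hT (iInf₂_le P hs)).trans (kl_self P).le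

/-! ### Rooted trees -/

/-- The graph joining every vertex to its parent. -/
def parentGraph {V : Type*} (pa : V → V) : SimpleGraph V :=
  SimpleGraph.fromRel fun i j => pa i = j

section ParentGraph

variable {V : Type*} {pa : V → V} {r : V} {d : V → ℕ}

theorem parentGraph_adj_parent (hd : ∀ i, i ≠ r → d i = d (pa i) + 1) {i : V} (hi : i ≠ r) :
    (parentGraph pa).Adj i (pa i) := by
  rw [parentGraph, SimpleGraph.fromRel_adj]
  refine ⟨fun h => ?_, Or.inl rfl⟩
  have := hd i hi
  rw [← h] at this
  omega

theorem exists_walk_length_eq_depth (hr : ∀ i, d i = 0 → i = r)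
    (hd : ∀ i, i ≠ r → d i = d (pa i) + 1) (i : V) :
    ∃ p : (parentGraph pa).Walk r i, p.length ≤ d i := by
  induction h : d i using Nat.strong_induction_on generalizing i with
  | _ m ih =>
    by_cases hi : i = r
    · subst hi; exact ⟨SimpleGraph.Walk.nil, by simp⟩
    · have h1 := hd i hi
      obtain ⟨p, hp⟩ := ih (d (pa i)) (by omega) (pa i) rfl
      refine ⟨p.concat (parentGraph_adj_parent hd hi).symm, ?_⟩
      rw [SimpleGraph.Walk.length_concat]; omega

/-- Depth changes by at most one along an edge. The convention `pa r = r` keeps the root from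
contributing an edge of its own. -/
theorem depth_le_add_length (hpr : pa r = r) (hd : ∀ i, i ≠ r → d i = d (pa i) + 1) {i j : V}
    (p : (parentGraph pa).Walk i j) : d j ≤ d i + p.length := by
  induction p with
  | nil => simp
  | @cons u v w h q ih =>
    rw [SimpleGraph.Walk.length_cons]
    have key : d v ≤ d u + 1 := by
      rw [parentGraph, SimpleGraph.fromRel_adj] at h
      rcases h with ⟨hne, h | h⟩
      · by_cases hu : u = r
        · exact absurd (by rw [← h, hu, hpr]) hne
        · have := hd u hu; rw [h] at this; omega
      · by_cases hv : v = r
        · exact absurd (by rw [← h, hv, hpr]) hne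
        · have := hd v hv; rw [h] at this; omega
    omega

theorem parentGraph_connected (hr : ∀ i, d i = 0 → i = r)
    (hd : ∀ i, i ≠ r → d i = d (pa i) + 1) : (parentGraph pa).Connected := by
  have : Nonempty V := ⟨r⟩
  have key : ∀ i, (parentGraph pa).Reachable r i := fun i =>
    ⟨(exists_walk_length_eq_depth hr hd i).choose⟩
  exact ⟨fun i j => (key i).symm.trans (key j)⟩

theorem parentGraph_dist (hpr : pa r = r) (hr : ∀ i, d i = 0 ↔ i = r)
    (hd : ∀ i, i ≠ r → d i = d (pa i) + 1) (i : V) : (parentGraph pa).dist r i = d i := by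
  apply le_antisymm
  · obtain ⟨p, hp⟩ := exists_walk_length_eq_depth (fun i => (hr i).1) hd i
    exact (SimpleGraph.dist_le p).trans hp
  · obtain ⟨p, hp⟩ :=
      (parentGraph_connected (fun i => (hr i).1) hd).exists_walk_length_eq_dist r i
    have := depth_le_add_length hpr hd p
    rw [(hr r).2 rfl] at this
    omega

theorem parentGraph_isParentMap (hpr : pa r = r) (hr : ∀ i, d i = 0 ↔ i = r)
    (hd : ∀ i, i ≠ r → d i = d (pa i) + 1) : IsParentMap (parentGraph pa) r pa := by
  intro i hi
  rw [parentGraph_dist hpr hr hd, parentGraph_dist hpr hr hd]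
  exact ⟨parentGraph_adj_parent hd hi, hd i hi⟩

/-- A connected graph with at most `|V| - 1` edges is a tree, and every edge joins some non-root
vertex to its parent. -/
theorem parentGraph_isTree [Finite V] (hr : ∀ i, d i = 0 → i = r) (hpr : pa r = r)
    (hd : ∀ i, i ≠ r → d i = d (pa i) + 1) : (parentGraph pa).IsTree := by
  classical
  have := Fintype.ofFinite V
  have hc := parentGraph_connected hr hd
  rw [SimpleGraph.isTree_iff_connected_and_card]
  refine ⟨hc, le_antisymm ?_ hc.card_vert_le_card_edgeSet_add_one⟩
  have hsub : (parentGraph pa).edgeSet ⊆ ((univ.erase r).image fun i => s(i, pa i) : Finset _) := by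
    intro e
    induction e with
    | h u v =>
      intro he
      rw [SimpleGraph.mem_edgeSet, parentGraph, SimpleGraph.fromRel_adj] at he
      rw [Finset.mem_coe, Finset.mem_image]
      rcases he with ⟨hne, h | h⟩
      · refine ⟨u, by simpa using fun hu => hne (by rw [← h, hu, hpr]), by rw [h]⟩
      · refine ⟨v, by simpa using fun hu => hne (by rw [← h, hu, hpr]), ?_⟩
        rw [h, Sym2.eq_swap]
  have h1 := Set.ncard_le_ncard hsub (Finset.finite_toSet _)
  rw [Set.ncard_coe_finset] at h1
  have h2 := (Finset.card_image_le (s := univ.erase r) (f := fun i => s(i, pa i)))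
  rw [Finset.card_erase_of_mem (mem_univ r), card_univ] at h2
  rw [Nat.card_coe_set_eq, Nat.card_eq_fintype_card]
  have : 0 < Fintype.card V := Fintype.card_pos_iff.2 ⟨r⟩
  omega

end ParentGraph

/-- Summing over non-root vertices and their parents is summing over the edges. -/
theorem IsParentMap.sum_eq {n : ℕ} {T : SimpleGraph (Fin n)} [Fintype T.edgeSet] (hT : T.IsTree)
    {r : Fin n} {pa : Fin n → Fin n} (h : IsParentMap T r pa) (f : Sym2 (Fin n) → ℝ) :
    ∑ i ∈ univ.erase r, f s(i, pa i) = ∑ e ∈ T.edgeFinset, f e := by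
  classical
  have hinj : Set.InjOn (fun i => s(i, pa i)) (univ.erase r : Finset (Fin n)) := by
    intro i hi j hj hij
    have hi' := (h i (by simpa using hi)).2
    have hj' := (h j (by simpa using hj)).2
    rcases Sym2.eq_iff.1 hij with ⟨h1, -⟩ | ⟨h1, h2⟩
    · exact h1
    -- Two vertices cannot be each other's parent, since each would be the deeper one.
    · rw [h2] at hi'; rw [← h1] at hj'; omega
  have himg : (univ.erase r).image (fun i => s(i, pa i)) = T.edgeFinset := by
    apply Finset.eq_of_subset_of_card_le
    · intro e he
      obtain ⟨i, hi, rfl⟩ := Finset.mem_image.1 he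
      rw [SimpleGraph.mem_edgeFinset, SimpleGraph.mem_edgeSet]
      exact (h i (by simpa using hi)).1
    · rw [Finset.card_image_of_injOn hinj, Finset.card_erase_of_mem (mem_univ r), card_univ]
      have := hT.card_edgeFinset
      omega
  rw [← himg, Finset.sum_image hinj]

/-! ### The hidden bits -/

section Hidden

variable {K : Type*}

/-- The law of a flip indicator with flip probability `δ`. -/
noncomputable def bitProb (δ : ℝ) (t : Bool) : ℝ := if t then δ else 1 - δ

/-- The weight of a uniform bit together with independent flip indicators. -/
noncomputable def noiseWeight [Fintype K] (δ : ℝ) (ω : Bool × (K → Bool)) : ℝ := 1 / 2 * ∏ k, bitProb δ (ω.2 k)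

/-- The base bit (at `none`), and its noisy copies. -/
def hiddenBit (ω : Bool × (K → Bool)) (o : Option K) : Bool := xor ω.1 (o.elim false ω.2)

open Classical in
/-- The probability that two of the hidden bits differ. -/
noncomputable def flipProb (δ : ℝ) (u v : Option K) : ℝ :=
  if u = v then 0 else if u = none ∨ v = none then δ else 2 * δ * (1 - δ)

theorem flipProb_comm (δ : ℝ) (u v : Option K) : flipProb δ u v = flipProb δ v u := by
  by_cases h : u = v
  · rw [h]
  · simp [flipProb, h, Ne.symm h, or_comm]

@[simp] theorem flipProb_self (δ : ℝ) (u : Option K) : flipProb δ u u = 0 := by simp [flipProb]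

theorem bitProb_pos {δ : ℝ} (h0 : 0 < δ) (h1 : δ < 1) (t : Bool) : 0 < bitProb δ t := by
  cases t <;> simp [bitProb, h0, h1]

variable [Fintype K] {δ : ℝ}

theorem noiseWeight_pos (h0 : 0 < δ) (h1 : δ < 1) (ω : Bool × (K → Bool)) :
    0 < noiseWeight δ ω :=
  mul_pos (by norm_num) (prod_pos fun _ _ => bitProb_pos h0 h1 _)

theorem sum_prod_bits [DecidableEq K] (f : K → Bool → ℝ) :
    ∑ F : K → Bool, ∏ k, f k (F k) = ∏ k, (f k true + f k false) := by
  rw [← Fintype.piFinset_univ, ← Finset.prod_univ_sum]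
  simp

theorem sum_noise [DecidableEq K] : ∑ F : K → Bool, ∏ k, bitProb δ (F k) = 1 := by
  rw [sum_prod_bits (fun _ => bitProb δ)]
  simp [bitProb]

theorem sum_noise_one [DecidableEq K] (k : K) (g : Bool → ℝ) :
    ∑ F : K → Bool, (∏ k, bitProb δ (F k)) * g (F k) = δ * g true + (1 - δ) * g false := by
  have h : ∀ F : K → Bool, (∏ k, bitProb δ (F k)) * g (F k) =
      ∏ j, (bitProb δ (F j) * if j = k then g (F j) else 1) := by
    intro F
    rw [prod_mul_distrib]; simp
  simp only [h]
  rw [sum_prod_bits (fun j t => bitProb δ t * if j = k then g t else 1),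
    Fintype.prod_eq_single k]
  · simp [bitProb]
  · intro j hj; simp [hj, bitProb]

theorem sum_noise_two [DecidableEq K] {k l : K} (hkl : k ≠ l) (g : Bool → Bool → ℝ) :
    ∑ F : K → Bool, (∏ k, bitProb δ (F k)) * g (F k) (F l) =
      δ * (δ * g true true + (1 - δ) * g true false) +
        (1 - δ) * (δ * g false true + (1 - δ) * g false false) := by
  have key : ∀ p q : Bool → ℝ, ∑ F : K → Bool, (∏ k, bitProb δ (F k)) * (p (F k) * q (F l)) =
      (δ * p true + (1 - δ) * p false) * (δ * q true + (1 - δ) * q false) := by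
    intro p q
    have h : ∀ F : K → Bool, (∏ k, bitProb δ (F k)) * (p (F k) * q (F l)) =
        ∏ j, (bitProb δ (F j) * ((if j = k then p (F j) else 1) * if j = l then q (F j) else 1)) := by
      intro F
      rw [prod_mul_distrib, prod_mul_distrib]; simp
    simp only [h]
    rw [sum_prod_bits (fun j t => bitProb δ t * ((if j = k then p t else 1) *
      if j = l then q t else 1)), Fintype.prod_eq_mul k l hkl]
    · simp [bitProb, hkl, hkl.symm]
    · intro j hj; simp [hj.1, hj.2, bitProb]
  -- Splitting `g` according to its first argument writes it as a sum of two products, to which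
  -- `key` applies.
  have hg : ∀ s t, g s t = (if s then 1 else 0) * g true t + (if s then 0 else 1) * g false t := by
    intro s t; cases s <;> simp
  have h1 := key (fun s => if s then 1 else 0) (g true)
  have h2 := key (fun s => if s then 0 else 1) (g false)
  calc _ = ∑ F : K → Bool, ((∏ k, bitProb δ (F k)) * ((if F k then 1 else 0) * g true (F l)) +
        (∏ k, bitProb δ (F k)) * ((if F k then 0 else 1) * g false (F l))) := by
        refine sum_congr rfl fun F _ => ?_
        rw [← mul_add, ← hg]
    _ = _ := by
        rw [sum_add_distrib, h1, h2]; simp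

theorem sum_noiseWeight_mul [DecidableEq K] (g : Bool → (K → Bool) → ℝ) :
    ∑ ω : Bool × (K → Bool), noiseWeight δ ω * g ω.1 ω.2 =
      1 / 2 * ∑ F : K → Bool, (∏ k, bitProb δ (F k)) * g true F +
      1 / 2 * ∑ F : K → Bool, (∏ k, bitProb δ (F k)) * g false F := by
  rw [Fintype.sum_prod_type, Fintype.sum_bool, mul_sum, mul_sum]
  simp only [noiseWeight, mul_assoc]

theorem sum_noiseWeight [DecidableEq K] : ∑ ω : Bool × (K → Bool), noiseWeight δ ω = 1 := by
  have := sum_noiseWeight_mul (K := K) (δ := δ) (fun _ _ => 1)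
  simp only [mul_one, sum_noise] at this
  rw [this]; norm_num

/-- The joint law of two hidden bits. -/
theorem sum_noiseWeight_pair [DecidableEq K] (u v : Option K) (g : Bool → Bool → ℝ) :
    ∑ ω : Bool × (K → Bool), noiseWeight δ ω * g (hiddenBit ω u) (hiddenBit ω v) =
      (1 - flipProb δ u v) / 2 * (g false false + g true true) +
        flipProb δ u v / 2 * (g false true + g true false) := by
  have := sum_noiseWeight_mul (K := K) (δ := δ)
    (fun b F => g (hiddenBit (b, F) u) (hiddenBit (b, F) v))
  simp only [Prod.mk.eta] at this
  rw [this]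
  simp only [hiddenBit]
  rcases u with _ | k <;> rcases v with _ | l
  · simp only [Option.elim, Bool.xor_false, ← sum_mul, sum_noise, flipProb_self]; ring
  · simp only [Option.elim, Bool.xor_false]
    rw [sum_noise_one l (fun t => g true (xor true t)),
      sum_noise_one l (fun t => g false (xor false t))]
    simp [flipProb]; ring
  · simp only [Option.elim, Bool.xor_false]
    rw [sum_noise_one k (fun t => g (xor true t) true),
      sum_noise_one k (fun t => g (xor false t) false)]
    simp [flipProb]; ring
  · simp only [Option.elim]
    by_cases hkl : k = l
    · subst hkl
      rw [sum_noise_one k (fun t => g (xor true t) (xor true t)),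
        sum_noise_one k (fun t => g (xor false t) (xor false t))]
      simp; ring
    · rw [sum_noise_two hkl (fun s t => g (xor true s) (xor true t)),
        sum_noise_two hkl (fun s t => g (xor false s) (xor false t))]
      simp [flipProb, hkl]; ring

/-- The entropy of the hidden bits. -/
theorem sum_noiseWeight_mul_log [DecidableEq K] (h0 : 0 < δ) (h1 : δ < 1) :
    ∑ ω : Bool × (K → Bool), noiseWeight δ ω * Real.log (noiseWeight δ ω) =
      -(Real.log 2 + Fintype.card K * Real.binEntropy δ) := by
  have hlog : ∀ ω : Bool × (K → Bool), Real.log (noiseWeight δ ω) =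
      -Real.log 2 + ∑ k, Real.log (bitProb δ (ω.2 k)) := by
    intro ω
    rw [noiseWeight, Real.log_mul (by norm_num)
      (prod_pos fun _ _ => bitProb_pos h0 h1 _).ne',
      Real.log_prod fun _ _ => (bitProb_pos h0 h1 _).ne', one_div, Real.log_inv]
  have hk : ∀ k, ∑ F : K → Bool, (∏ k, bitProb δ (F k)) * Real.log (bitProb δ (F k)) =
      -Real.binEntropy δ := by
    intro k
    rw [sum_noise_one k (fun t => Real.log (bitProb δ t)), Real.binEntropy]
    simp [bitProb]; ring
  have hF : ∑ F : K → Bool, (∏ k, bitProb δ (F k)) *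
      (-Real.log 2 + ∑ k, Real.log (bitProb δ (F k))) =
        -(Real.log 2 + Fintype.card K * Real.binEntropy δ) := by
    simp only [mul_add, sum_add_distrib, ← sum_mul, sum_noise, mul_sum]
    rw [sum_comm]
    simp only [hk]
    simp; ring
  simp only [hlog]
  rw [sum_noiseWeight_mul (fun _ F => -Real.log 2 + ∑ k, Real.log (bitProb δ (F k))), hF]
  ring

end Hidden

/-- Gibbs' inequality for a biased bit. -/
theorem binEntropy_le_cross_entropy {s a b : ℝ} (hs0 : 0 ≤ s) (hs1 : s ≤ 1) (ha : 0 < a)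
    (hb : 0 < b) (hab : a + b ≤ 1) :
    Real.binEntropy s ≤ -((1 - s) * Real.log a + s * Real.log b) := by
  have key : ∀ p t : ℝ, 0 ≤ p → 0 < t → p * Real.log p⁻¹ + p * Real.log t ≤ t - p := by
    intro p t hp ht
    rcases hp.eq_or_lt with rfl | hp
    · simpa using ht.le
    · rw [← mul_add, ← Real.log_mul (by positivity) ht.ne']
      calc p * Real.log (p⁻¹ * t) ≤ p * (p⁻¹ * t - 1) :=
            mul_le_mul_of_nonneg_left (Real.log_le_sub_one_of_pos (by positivity)) hp.le
        _ = t - p := by field_simp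
  have h1 := key s b hs0 hb
  have h2 := key (1 - s) a (by linarith) ha
  rw [Real.binEntropy]
  linarith

theorem map_apply_of_injective {α β : Type*} (p : PMF α) {f : α → β}
    (hf : Function.Injective f) (a : α) : p.map f (f a) = p a := by
  classical
  rw [PMF.map_apply, tsum_eq_single a]
  · simp
  · intro b hb; rw [if_neg]; exact fun h => hb (hf h).symm

theorem map_apply_ne_zero {α β : Type*} (p : PMF α) {f : α → β} {b : β} (h : p.map f b ≠ 0) :
    ∃ a, f a = b := by
  have := (PMF.mem_support_iff _ _).2 h
  rw [PMF.mem_support_map_iff] at this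
  obtain ⟨a, -, ha⟩ := this
  exact ⟨a, ha⟩

/-! ### The hard distributions -/

section Model

variable {K A : Type*} {n : ℕ} {δ : ℝ}

/-- The law of a biased bit. -/
noncomputable def bitLaw (h0 : 0 < δ) (h1 : δ < 1) : PMF Bool :=
  PMF.ofFintype (fun t => ENNReal.ofReal (bitProb δ t)) (by
    rw [← ENNReal.ofReal_sum_of_nonneg fun t _ => (bitProb_pos h0 h1 t).le]
    simp [bitProb])

/-- The `i`-th observed variable is a copy of the hidden bit with label `θ i`. -/
def observe (e : Bool → A) (θ : Fin n → Option K) (ω : Bool × (K → Bool)) : Fin n → A :=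
  fun i => e (hiddenBit ω (θ i))

/-- When every label is used, the hidden bits can be read off from the observation. The model is
then a relabelling of the hidden law, so masses and entropies carry over. -/
theorem observe_injective {e : Bool → A} (he : Function.Injective e) {θ : Fin n → Option K}
    (hθ : Function.Surjective θ) : Function.Injective (observe e θ) := by
  have key : ∀ ω ω' : Bool × (K → Bool), observe e θ ω = observe e θ ω' →
      ∀ o, hiddenBit ω o = hiddenBit ω' o := by
    intro ω ω' h o
    obtain ⟨i, rfl⟩ := hθ o
    exact he (congrFun h i)
  rintro ⟨b, F⟩ ⟨b', F'⟩ h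
  have hb : b = b' := by simpa [hiddenBit] using key _ _ h none
  subst hb
  have hF : F = F' := funext fun k => by simpa [hiddenBit] using key _ _ h (some k)
  rw [hF]

/-- The parent map of a tree of depth at most two for the labelling `θ` with representatives `s`. -/
def labelParent (θ : Fin n → Option K) (s : Option K → Fin n) (i : Fin n) : Fin n :=
  if i = s (θ i) then s none else s (θ i)

/-- The depth function of that tree. -/
def labelDepth (θ : Fin n → Option K) (s : Option K → Fin n) (i : Fin n) : ℕ :=
  if i = s none then 0 else if i = s (θ i) ∨ θ i = none then 1 else 2

theorem labelParent_root {θ : Fin n → Option K} {s : Option K → Fin n} (hs : ∀ o, θ (s o) = o) :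
    labelParent θ s (s none) = s none := by simp [labelParent, hs]

theorem labelDepth_eq_zero {θ : Fin n → Option K} {s : Option K → Fin n} (i : Fin n) :
    labelDepth θ s i = 0 ↔ i = s none := by
  unfold labelDepth
  split_ifs <;> simp_all

theorem labelDepth_succ {θ : Fin n → Option K} {s : Option K → Fin n} (hs : ∀ o, θ (s o) = o)
    (i : Fin n) (hi : i ≠ s none) :
    labelDepth θ s i = labelDepth θ s (labelParent θ s i) + 1 := by
  by_cases h : i = s (θ i)
  · rw [labelParent, if_pos h, (labelDepth_eq_zero _).2 rfl, labelDepth, if_neg hi,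
      if_pos (Or.inl h)]
  · rw [labelParent, if_neg h]
    by_cases h' : θ i = none
    · rw [h', (labelDepth_eq_zero _).2 rfl, labelDepth, if_neg hi, if_pos (Or.inr h')]
    · have : s (θ i) ≠ s none := fun hc => h' (by rw [← hs (θ i), hc, hs])
      simp [labelDepth, hi, h, h', this, hs]

open Classical in
/-- The conditional laws of that tree: copies of the parent, or noisy copies of the root. -/
noncomputable def labelKernel (h0 : 0 < δ) (h1 : δ < 1) (e : Bool → A) (θ : Fin n → Option K)
    (s : Option K → Fin n) (i : Fin n) (y : A) : PMF A :=
  if i = s (θ i) then (bitLaw h0 h1).map fun t => e (xor (decide (y = e true)) t) else PMF.pure y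

theorem labelKernel_observe (h0 : 0 < δ) (h1 : δ < 1) {e : Bool → A}
    (he : Function.Injective e) {θ : Fin n → Option K} {s : Option K → Fin n}
    (hs : ∀ o, θ (s o) = o) (ω : Bool × (K → Bool)) (k : K) :
    labelKernel h0 h1 e θ s (s (some k)) (observe e θ ω (labelParent θ s (s (some k))))
      (observe e θ ω (s (some k))) = ENNReal.ofReal (bitProb δ (ω.2 k)) := by
  classical
  -- The kernel decodes the root's letter back to the base bit.
  have hd : decide (e ω.1 = e true) = ω.1 := by
    cases h : ω.1
    · simpa using fun hc => absurd (he hc) (by simp)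
    · simp
  simp only [labelKernel, labelParent, hs, observe, if_true, hiddenBit, Option.elim,
    Bool.xor_false, hd]
  rw [map_apply_of_injective (f := fun t => e (xor ω.1 t)) _
    fun t t' h => by simpa using he h]
  rfl

variable [Fintype K] [DecidableEq K]

/-- The law of the hidden bits. -/
noncomputable def hiddenLaw (K : Type*) [Fintype K] [DecidableEq K] (h0 : 0 < δ) (h1 : δ < 1) :
    PMF (Bool × (K → Bool)) :=
  PMF.ofFintype (fun ω => ENNReal.ofReal (noiseWeight δ ω)) (by
    rw [← ENNReal.ofReal_sum_of_nonneg fun t _ => (noiseWeight_pos h0 h1 t).le,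
      sum_noiseWeight, ENNReal.ofReal_one])

/-- The law of the observed variables. -/
noncomputable def model (h0 : 0 < δ) (h1 : δ < 1) (e : Bool → A) (θ : Fin n → Option K) :
    PMF (Fin n → A) :=
  (hiddenLaw K h0 h1).map (observe e θ)

theorem model_apply_observe (h0 : 0 < δ) (h1 : δ < 1) {e : Bool → A}
    (he : Function.Injective e) {θ : Fin n → Option K} (hθ : Function.Surjective θ)
    (ω : Bool × (K → Bool)) :
    model h0 h1 e θ (observe e θ ω) = ENNReal.ofReal (noiseWeight δ ω) := by
  rw [model, map_apply_of_injective _ (observe_injective he hθ)]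
  rfl

/-- One representative is chosen per label. The representative of `none` is the root, the others are
noisy children of it, and every remaining vertex copies its representative; only the representatives
contribute nontrivial factors. -/
theorem model_isTreeStructured (h0 : 0 < δ) (h1 : δ < 1) {e : Bool → A}
    (he : Function.Injective e) {θ : Fin n → Option K} (hθ : Function.Surjective θ) :
    IsTreeStructured (model h0 h1 e θ) := by
  classical
  obtain ⟨s, hs : ∀ o, θ (s o) = o⟩ := hθ.hasRightInverse
  have hpr := labelParent_root hs
  refine ⟨parentGraph (labelParent θ s), parentGraph_isTree
    (fun i => (labelDepth_eq_zero i).1) hpr (labelDepth_succ hs), s none, labelParent θ s,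
    (bitLaw (δ := 1 / 2) (by norm_num) (by norm_num)).map e, labelKernel h0 h1 e θ s,
    parentGraph_isParentMap hpr labelDepth_eq_zero (labelDepth_succ hs), fun x => ?_⟩
  by_cases hx : ∃ ω, observe e θ ω = x
  · obtain ⟨ω, rfl⟩ := hx
    rw [model_apply_observe h0 h1 he hθ]
    have hroot : (bitLaw (δ := 1 / 2) (by norm_num) (by norm_num)).map e
        (observe e θ ω (s none)) = ENNReal.ofReal (1 / 2) := by
      rw [observe, map_apply_of_injective _ he]
      change ENNReal.ofReal (bitProb (1 / 2) _) = _
      congr 1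
      unfold bitProb; split_ifs <;> norm_num
    have hsinj : Function.Injective fun k => s (some k) := fun k l h => by
      simpa [hs (some k), hs (some l)] using congrArg θ h
    have hprod : ∏ i ∈ univ.erase (s none),
        labelKernel h0 h1 e θ s i (observe e θ ω (labelParent θ s i)) (observe e θ ω i) =
        ∏ k, ENNReal.ofReal (bitProb δ (ω.2 k)) := by
      rw [← Finset.prod_subset (s₁ := univ.image fun k => s (some k))]
      · rw [Finset.prod_image hsinj.injOn]
        exact Finset.prod_congr rfl fun k _ => labelKernel_observe h0 h1 he hs ω k
      · intro i hi
        obtain ⟨k, -, rfl⟩ := Finset.mem_image.1 hi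
        rw [Finset.mem_erase]
        exact ⟨fun h => by simpa [hs] using congrArg θ h, mem_univ _⟩
      · intro i hi hni
        have hi' : i ≠ s (θ i) := by
          intro h
          cases hθi : θ i with
          | none => rw [hθi] at h; simp [h] at hi
          | some k => rw [hθi] at h; exact hni (Finset.mem_image.2 ⟨k, mem_univ _, h.symm⟩)
        simp [labelKernel, labelParent, hi', observe, hs]
    rw [hroot, hprod, noiseWeight, ENNReal.ofReal_mul (by norm_num),
      ENNReal.ofReal_prod_of_nonneg fun k _ => (bitProb_pos h0 h1 _).le]
  · have hl : model h0 h1 e θ x = 0 := by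
      by_contra h; exact hx (map_apply_ne_zero _ h)
    rw [hl, eq_comm]
    -- If the factorization were positive at `x`, the root would give the base bit, the
    -- representatives the flips, and the copying kernels the rest, putting `x` in the range of
    -- `observe`.
    by_contra h
    obtain ⟨hr, hprod⟩ := mul_ne_zero_iff.1 h
    rw [Finset.prod_ne_zero_iff] at hprod
    obtain ⟨b, hb⟩ := map_apply_ne_zero _ hr
    have hrep : ∀ k, ∃ t, e (xor b t) = x (s (some k)) := by
      intro k
      have h2 := hprod (s (some k)) (by
        rw [Finset.mem_erase]
        exact ⟨fun h => by simpa [hs] using congrArg θ h, mem_univ _⟩)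
      simp only [labelKernel, labelParent, hs, if_true] at h2
      obtain ⟨t, ht⟩ := map_apply_ne_zero _ h2
      refine ⟨xor b (xor (decide (x (s none) = e true)) t), ?_⟩
      rw [← ht]; congr 1; simp
    choose F hF using hrep
    refine hx ⟨(b, F), funext fun i => ?_⟩
    have hrepi : e (hiddenBit (b, F) (θ i)) = x (s (θ i)) := by
      cases θ i with
      | none => simpa [hiddenBit] using hb
      | some k => simpa [hiddenBit] using hF k
    rw [observe, hrepi]
    by_cases hi : i = s (θ i)
    · rw [← hi]
    · have h2 := hprod i (by
        rw [Finset.mem_erase]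
        refine ⟨fun h => hi ?_, mem_univ _⟩
        rw [h, hs])
      simp only [labelKernel, labelParent, if_neg hi, PMF.pure_apply] at h2
      by_contra hne
      exact h2 (if_neg fun hc => hne hc.symm)

end Model

/-! ### Lower bound for the divergence from a structured distribution -/

theorem toReal_add_toReal_le_one {α : Type*} (p : PMF α) {a b : α} (hab : a ≠ b) :
    (p a).toReal + (p b).toReal ≤ 1 := by
  classical
  rw [← ENNReal.toReal_add (p.apply_ne_top a) (p.apply_ne_top b)]
  have h : p a + p b ≤ 1 := by
    rw [← p.tsum_coe, ← Finset.sum_pair hab]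
    exact ENNReal.sum_le_tsum _
  simpa using ENNReal.toReal_mono ENNReal.one_ne_top h

theorem log_toReal_nonpos {α : Type*} (p : PMF α) (a : α) : Real.log (p a).toReal ≤ 0 :=
  Real.log_nonpos ENNReal.toReal_nonneg
    (by simpa using ENNReal.toReal_mono ENNReal.one_ne_top (p.coe_le_one a))

section Divergence

variable {K A : Type*} {n : ℕ} {δ : ℝ}

theorem exists_hiddenBit_eq (u : Option K) (y : Bool) :
    ∃ ω : Bool × (K → Bool), hiddenBit ω u = y :=
  ⟨(y, fun _ => false), by cases u <;> simp [hiddenBit]⟩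

theorem exists_hiddenBit_eq_and_eq {u v : Option K} (huv : u ≠ v) (y z : Bool) :
    ∃ ω : Bool × (K → Bool), hiddenBit ω u = y ∧ hiddenBit ω v = z := by
  classical
  rcases u with _ | k <;> rcases v with _ | l
  · exact absurd rfl huv
  · exact ⟨(y, fun _ => xor y z), by simp [hiddenBit]⟩
  · exact ⟨(z, fun _ => xor z y), by simp [hiddenBit]⟩
  · have hlk : l ≠ k := fun h => huv (by rw [h])
    exact ⟨(false, fun j => if j = k then y else z), by simp [hiddenBit, hlk]⟩

theorem flipProb_nonneg (h0 : 0 < δ) (h1 : δ < 1) (u v : Option K) : 0 ≤ flipProb δ u v := by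
  unfold flipProb
  split_ifs
  · exact le_rfl
  · exact h0.le
  · nlinarith

theorem flipProb_le_one (h1 : δ < 1) (u v : Option K) : flipProb δ u v ≤ 1 := by
  unfold flipProb
  split_ifs
  · exact zero_le_one
  · exact h1.le
  · nlinarith [sq_nonneg δ, sq_nonneg (1 - δ)]

/-- The probability that the hidden bits at the two ends of an edge differ. -/
noncomputable def edgeFlip (δ : ℝ) (θ : Fin n → Option K) : Sym2 (Fin n) → ℝ :=
  Sym2.lift ⟨fun i j => flipProb δ (θ i) (θ j), fun _ _ => flipProb_comm _ _ _⟩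

@[simp] theorem edgeFlip_mk (δ : ℝ) (θ : Fin n → Option K) (i j : Fin n) :
    edgeFlip δ θ s(i, j) = flipProb δ (θ i) (θ j) := rfl

variable [Fintype K] [DecidableEq K]

/-- Gibbs' inequality for each of the two values of the parent bit. Letters outside the range of `e`
may take some mass, so each row is only a subprobability on the two letters used. If `u = v`, the
right side is zero and nonpositivity of the logarithms suffices. -/
theorem sum_log_kernel_le (h0 : 0 < δ) (h1 : δ < 1) {e : Bool → A}
    (he : Function.Injective e) (u v : Option K) (κ : A → PMF A)
    (hκ : ∀ ω : Bool × (K → Bool), κ (e (hiddenBit ω u)) (e (hiddenBit ω v)) ≠ 0) :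
    ∑ ω : Bool × (K → Bool), noiseWeight δ ω *
      Real.log (κ (e (hiddenBit ω u)) (e (hiddenBit ω v))).toReal ≤
        -Real.binEntropy (flipProb δ u v) := by
  rw [sum_noiseWeight_pair u v fun y z => Real.log (κ (e y) (e z)).toReal]
  by_cases huv : u = v
  · subst huv
    have := log_toReal_nonpos (κ (e false)) (e false)
    have := log_toReal_nonpos (κ (e true)) (e true)
    simp
    linarith
  · have hpos : ∀ y z, 0 < (κ (e y) (e z)).toReal := by
      intro y z
      obtain ⟨ω, rfl, rfl⟩ := exists_hiddenBit_eq_and_eq huv y z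
      exact ENNReal.toReal_pos (hκ ω) (PMF.apply_ne_top _ _)
    have hs0 := flipProb_nonneg h0 h1 u v
    have hs1 := flipProb_le_one h1 u v
    have hne : e false ≠ e true := fun h => by simpa using he h
    have hf := binEntropy_le_cross_entropy hs0 hs1 (hpos false false) (hpos false true)
      (toReal_add_toReal_le_one _ hne)
    have ht := binEntropy_le_cross_entropy hs0 hs1 (hpos true true) (hpos true false)
      (toReal_add_toReal_le_one _ hne.symm)
    linarith

theorem sum_log_root_le {e : Bool → A}
    (he : Function.Injective e) (u : Option K) (ρ : PMF A)
    (hρ : ∀ ω : Bool × (K → Bool), ρ (e (hiddenBit ω u)) ≠ 0) :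
    ∑ ω : Bool × (K → Bool), noiseWeight δ ω * Real.log (ρ (e (hiddenBit ω u))).toReal ≤
      -Real.log 2 := by
  rw [sum_noiseWeight_pair u u fun y _ => Real.log (ρ (e y)).toReal]
  have hpos : ∀ y, 0 < (ρ (e y)).toReal := by
    intro y
    obtain ⟨ω, rfl⟩ := exists_hiddenBit_eq u y
    exact ENNReal.toReal_pos (hρ ω) (PMF.apply_ne_top _ _)
  have hne : e false ≠ e true := fun h => by simpa using he h
  have h := binEntropy_le_cross_entropy (s := 2⁻¹) (by norm_num) (by norm_num) (hpos false)
    (hpos true) (toReal_add_toReal_le_one _ hne)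
  rw [Real.binEntropy_two_inv] at h
  simp
  linarith

/-- A lower bound on the divergence from the model to the distributions structured by `T`. -/
theorem sum_binEntropy_le_of_kl_le (h0 : 0 < δ) (h1 : δ < 1) [Fintype A] {e : Bool → A}
    (he : Function.Injective e) {θ : Fin n → Option K} (hθ : Function.Surjective θ)
    {T : SimpleGraph (Fin n)} [Fintype T.edgeSet] (hT : T.IsTree) {Q : PMF (Fin n → A)}
    (hQ : IsStructured T Q) {ε : ℝ} (hε : 0 ≤ ε)
    (hkl : kl (model h0 h1 e θ) Q ≤ ENNReal.ofReal ε) :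
    ∑ s ∈ T.edgeFinset, Real.binEntropy (edgeFlip δ θ s) - Fintype.card K * Real.binEntropy δ ≤
      ε := by
  obtain ⟨r, pa, ρ, κ, hpa, hfac⟩ := hQ
  obtain ⟨hsupp, hsum⟩ := kl_lower_bound _ _ hε hkl
  have hreal : ∀ ω, (model h0 h1 e θ (observe e θ ω)).toReal = noiseWeight δ ω := fun ω => by
    rw [model_apply_observe h0 h1 he hθ, ENNReal.toReal_ofReal (noiseWeight_pos h0 h1 ω).le]
  have hQne : ∀ ω, Q (observe e θ ω) ≠ 0 := fun ω => hsupp _ fun h => by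
    have := hreal ω
    rw [h, ENNReal.toReal_zero] at this
    exact (noiseWeight_pos h0 h1 ω).ne this
  have hρ : ∀ ω : Bool × (K → Bool), ρ (e (hiddenBit ω (θ r))) ≠ 0 := fun ω h =>
    hQne ω (by rw [hfac]; exact mul_eq_zero_of_left h _)
  have hκ : ∀ i ∈ univ.erase r, ∀ ω : Bool × (K → Bool),
      κ i (e (hiddenBit ω (θ (pa i)))) (e (hiddenBit ω (θ i))) ≠ 0 := fun i hi ω h =>
    hQne ω (by rw [hfac]; exact mul_eq_zero_of_right _ (prod_eq_zero hi h))
  have hlogQ : ∀ ω, Real.log (Q (observe e θ ω)).toReal =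
      Real.log (ρ (e (hiddenBit ω (θ r)))).toReal + ∑ i ∈ univ.erase r,
        Real.log (κ i (e (hiddenBit ω (θ (pa i)))) (e (hiddenBit ω (θ i)))).toReal := by
    intro ω
    rw [hfac, ENNReal.toReal_mul, ENNReal.toReal_prod, Real.log_mul, Real.log_prod]
    · rfl
    · exact fun i hi => (ENNReal.toReal_pos (hκ i hi ω) (PMF.apply_ne_top _ _)).ne'
    · exact (ENNReal.toReal_pos (hρ ω) (PMF.apply_ne_top _ _)).ne'
    · exact prod_ne_zero_iff.2 fun i hi =>
        (ENNReal.toReal_pos (hκ i hi ω) (PMF.apply_ne_top _ _)).ne'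
  have hmove : ∑ x, (model h0 h1 e θ x).toReal *
      Real.log ((model h0 h1 e θ x).toReal / (Q x).toReal) =
      ∑ ω : Bool × (K → Bool), noiseWeight δ ω *
        (Real.log (noiseWeight δ ω) - Real.log (Q (observe e θ ω)).toReal) := by
    symm
    refine Fintype.sum_of_injective (observe e θ) (observe_injective he hθ) _ _ ?_ ?_
    · intro x hx
      have : model h0 h1 e θ x = 0 := by
        by_contra h; exact hx (map_apply_ne_zero _ h)
      simp [this]
    · intro ω
      rw [hreal, Real.log_div (noiseWeight_pos h0 h1 ω).ne'
        (ENNReal.toReal_pos (hQne ω) (PMF.apply_ne_top _ _)).ne']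
  rw [hmove] at hsum
  simp only [hlogQ, mul_sub, mul_add, sum_sub_distrib, sum_add_distrib, mul_sum] at hsum
  -- The `log 2` in the entropy of the model is cancelled by the root term bounded in `hroot`.
  rw [sum_noiseWeight_mul_log h0 h1, sum_comm] at hsum
  have hroot := sum_log_root_le (δ := δ) he (θ r) ρ hρ
  have hedges : ∑ i ∈ univ.erase r, ∑ ω : Bool × (K → Bool), noiseWeight δ ω *
      Real.log (κ i (e (hiddenBit ω (θ (pa i)))) (e (hiddenBit ω (θ i)))).toReal ≤
      -∑ s ∈ T.edgeFinset, Real.binEntropy (edgeFlip δ θ s) := by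
    rw [← hpa.sum_eq hT fun s => Real.binEntropy (edgeFlip δ θ s), ← sum_neg_distrib]
    refine sum_le_sum fun i hi => ?_
    rw [edgeFlip_mk, flipProb_comm]
    exact sum_log_kernel_le h0 h1 he _ _ _ (hκ i hi)
  linarith

theorem IsApproxTree.sum_binEntropy_le (h0 : 0 < δ) (h1 : δ < 1) [Fintype A] {e : Bool → A}
    (he : Function.Injective e) {θ : Fin n → Option K} (hθ : Function.Surjective θ)
    {T : SimpleGraph (Fin n)} [Fintype T.edgeSet] {ε : ℝ} (hε : 0 ≤ ε)
    (h : IsApproxTree ε (model h0 h1 e θ) T) :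
    ∑ s ∈ T.edgeFinset, Real.binEntropy (edgeFlip δ θ s) - Fintype.card K * Real.binEntropy δ ≤
      ε := by
  obtain ⟨hT, Q, hQ, hkl⟩ := h
  rw [bestTreeDivergence_eq_zero (model_isTreeStructured h0 h1 he hθ), add_zero] at hkl
  exact sum_binEntropy_le_of_kl_le h0 h1 he hθ hT hQ hε hkl

end Divergence

/-! ### Averaging over a family of distributions -/

/-- On the mass `g ^ N` common to all members of the family, the output does not depend on `θ`. Any
output is wrong for at least half of `Θ`, so the average error is at least half of that common mass.
-/
theorem pow_le_of_average_error {ι A : Type*} [Fintype A] {n N : ℕ} (alg : TreeAlgorithm A n N)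
    {ε : ℝ} {Θ : Finset ι} (hΘ : Θ.Nonempty) (P : ι → PMF (Fin n → A))
    (g : (Fin n → A) → ℝ≥0∞) (hg : ∀ θ ∈ Θ, ∀ x, g x ≤ P θ x)
    (hbad : ∀ T : SimpleGraph (Fin n), T.IsTree →
      ∃ B ⊆ Θ, (∀ θ ∈ B, ¬ IsApproxTree ε (P θ) T) ∧ #Θ ≤ 2 * #B)
    (herr : ∀ θ ∈ Θ, errorProb alg ε (P θ) ≤ 1 / 3) :
    (∑ x, g x) ^ N ≤ 2 / 3 := by
  classical
  let bad : ι → Set {T : SimpleGraph (Fin n) // T.IsTree} := fun θ => {T | ¬ IsApproxTree ε (P θ) T.1}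
  have hone : ∀ s, ∑ T, alg s T = 1 := fun s => by
    rw [← tsum_fintype (L := .unconditional _)]; exact (alg s).tsum_coe
  have hpow : (∑ x, g x) ^ N = ∑ s : Fin N → (Fin n → A), ∏ j, g (s j) := by
    simpa using Finset.prod_univ_sum (fun _ : Fin N => (univ : Finset (Fin n → A))) fun _ => g
  have hcount : ∀ T : {T : SimpleGraph (Fin n) // T.IsTree},
      (#Θ : ℝ≥0∞) ≤ 2 * ∑ θ ∈ Θ, (bad θ).indicator 1 T := by
    intro T
    obtain ⟨B, hB, hbadB, hcard⟩ := hbad T.1 T.2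
    have h1 : (#B : ℝ≥0∞) ≤ ∑ θ ∈ Θ, (bad θ).indicator 1 T := by
      rw [Finset.cast_card]
      calc ∑ θ ∈ B, (1 : ℝ≥0∞) ≤ ∑ θ ∈ B, (bad θ).indicator 1 T :=
            sum_le_sum fun θ hθ => by
              rw [Set.indicator_of_mem (show T ∈ bad θ from hbadB θ hθ)]; rfl
        _ ≤ _ := sum_le_sum_of_subset hB
    calc (#Θ : ℝ≥0∞) ≤ 2 * #B := by exact_mod_cast hcard
      _ ≤ _ := by gcongr
  have herr_eq : ∀ θ, errorProb alg ε (P θ) =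
      ∑ s, iidSamples (P θ) N s * ∑ T, alg s T * (bad θ).indicator 1 T := by
    intro θ
    rw [errorProb, PMF.toOuterMeasure_bind_apply, tsum_fintype]
    refine sum_congr rfl fun s _ => ?_
    rw [PMF.toOuterMeasure_apply_fintype]
    congr 1
    refine sum_congr rfl fun T _ => ?_
    by_cases hT : T ∈ bad θ
    · rw [Set.indicator_of_mem hT, Set.indicator_of_mem (by exact hT)]; simp
    · rw [Set.indicator_of_notMem hT, Set.indicator_of_notMem (by exact hT)]; simp
  have hle : (#Θ : ℝ≥0∞) * (∑ x, g x) ^ N ≤ #Θ * (2 / 3) := by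
    calc (#Θ : ℝ≥0∞) * (∑ x, g x) ^ N
        = ∑ s, (∏ j, g (s j)) * ∑ T, alg s T * #Θ := by
          rw [hpow, mul_comm, sum_mul]
          refine sum_congr rfl fun s _ => ?_
          rw [← sum_mul, hone, one_mul]
      _ ≤ ∑ s, (∏ j, g (s j)) * ∑ T, alg s T * (2 * ∑ θ ∈ Θ, (bad θ).indicator 1 T) := by
          gcongr; exact hcount _
      _ = 2 * ∑ θ ∈ Θ, ∑ s, (∏ j, g (s j)) * ∑ T, alg s T * (bad θ).indicator 1 T := by
          rw [sum_comm, mul_sum]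
          refine sum_congr rfl fun s _ => ?_
          rw [← mul_sum, ← mul_assoc, mul_comm 2, mul_assoc, sum_comm, mul_sum (a := 2)]
          congr 1
          refine sum_congr rfl fun T _ => ?_
          rw [← mul_sum]; ring
      _ ≤ 2 * ∑ θ ∈ Θ, errorProb alg ε (P θ) := by
          gcongr with θ hθ
          rw [herr_eq]
          gcongr with s
          exact prod_le_prod' fun j _ => hg θ hθ _
      _ ≤ 2 * ∑ θ ∈ Θ, 1 / 3 := by gcongr with θ hθ; exact herr θ hθ
      _ = #Θ * (2 / 3) := by
          rw [sum_const, nsmul_eq_mul]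
          simp only [div_eq_mul_inv]; ring
  exact (ENNReal.mul_le_mul_iff_right (by simpa using hΘ.ne_empty) (by simp)).1 hle

/-- An algorithm with small error for a family of models, half of which are bad for every tree,
needs many samples: most of the time the samples carry no information. -/
theorem card_mul_samples_ge {K A : Type*} [Fintype K] [DecidableEq K] [Fintype A] {n N : ℕ}
    (alg : TreeAlgorithm A n N) {ε δ : ℝ} (h0 : 0 < δ) (h1 : δ < 1) {e : Bool → A}
    (he : Function.Injective e) {Θ : Finset (Fin n → Option K)} (hΘ : Θ.Nonempty)
    (hsurj : ∀ θ ∈ Θ, Function.Surjective θ)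
    (hbad : ∀ T : SimpleGraph (Fin n), T.IsTree →
      ∃ B ⊆ Θ, (∀ θ ∈ B, ¬ IsApproxTree ε (model h0 h1 e θ) T) ∧ #Θ ≤ 2 * #B)
    (herr : ∀ P : PMF (Fin n → A), IsTreeStructured P → errorProb alg ε P < 1 / 3) :
    1 / 3 ≤ Fintype.card K * N * δ := by
  classical
  obtain ⟨θ₀, hθ₀⟩ := hΘ
  obtain ⟨i₀, -⟩ := hsurj θ₀ hθ₀ none
  set q : ℝ := 1 / 2 * (1 - δ) ^ Fintype.card K with hq
  have hqpos : 0 ≤ q := by have := sub_pos.2 h1; positivity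
  have hconst : ∀ θ ∈ Θ, ∀ b, model h0 h1 e θ (fun _ => e b) = ENNReal.ofReal q := by
    intro θ hθ b
    have h : observe e θ (b, fun _ => false) = fun _ => e b := by
      funext i
      rw [observe]
      cases θ i <;> simp [hiddenBit]
    rw [← h, model_apply_observe h0 h1 he (hsurj θ hθ)]
    simp [noiseWeight, bitProb, hq]
  have hne : (fun _ : Fin n => e false) ≠ fun _ => e true := fun h => by
    simpa using he (congrFun h i₀)
  -- The common part consists of the two constant samples, which arise when no bit is flipped.
  let g : (Fin n → A) → ℝ≥0∞ := fun x =>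
    (if x = fun _ => e false then ENNReal.ofReal q else 0) +
      if x = fun _ => e true then ENNReal.ofReal q else 0
  have hg : ∀ θ ∈ Θ, ∀ x, g x ≤ model h0 h1 e θ x := by
    intro θ hθ x
    by_cases hf : x = fun _ => e false
    · simp [g, hf, hne, hconst θ hθ]
    · by_cases ht : x = fun _ => e true
      · simp [g, ht, hne.symm, hconst θ hθ]
      · simp [g, hf, ht]
  have hsum : ∑ x, g x = ENNReal.ofReal ((1 - δ) ^ Fintype.card K) := by
    simp only [g, sum_add_distrib, sum_ite_eq', mem_univ, if_true]
    rw [← ENNReal.ofReal_add hqpos hqpos, hq]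
    congr 1; ring
  have key := pow_le_of_average_error alg ⟨θ₀, hθ₀⟩ (fun θ => model h0 h1 e θ) g hg hbad
    fun θ hθ => (herr _ (model_isTreeStructured h0 h1 he (hsurj θ hθ))).le
  rw [hsum, ← ENNReal.ofReal_pow (by have := sub_pos.2 h1; positivity), ← pow_mul,
    show (2 / 3 : ℝ≥0∞) = ENNReal.ofReal (2 / 3) by
      rw [ENNReal.ofReal_div_of_pos (by norm_num)]; simp,
    ENNReal.ofReal_le_ofReal_iff (by norm_num)] at key
  -- Bernoulli's inequality: `1 - |K| N δ ≤ (1 - δ) ^ (|K| N) ≤ 2/3`.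
  have hb := one_add_mul_le_pow (a := -δ) (by linarith) (Fintype.card K * N)
  push_cast at hb
  rw [← sub_eq_add_neg] at hb
  linarith

/-! ### Two hidden bits, and at least four variables -/

/-- The other one of the two labels. -/
def otherLabel (o : Option Unit) : Option Unit := if o = none then some () else none

theorem otherLabel_otherLabel (o : Option Unit) : otherLabel (otherLabel o) = o := by
  revert o; decide

/-- With two labels, exactly one of `v` and `otherLabel v` differs from `u`. -/
theorem binEntropy_flipProb_add (δ : ℝ) (u v : Option Unit) :
    Real.binEntropy (flipProb δ u v) + Real.binEntropy (flipProb δ u (otherLabel v)) =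
      Real.binEntropy δ := by
  rcases u with _ | _ <;> rcases v with _ | _ <;> simp [flipProb, otherLabel]

theorem flipProb_otherLabel (δ : ℝ) (u v : Option Unit) :
    flipProb δ (otherLabel u) v = flipProb δ u (otherLabel v) := by
  rcases u with _ | _ <;> rcases v with _ | _ <;> simp [flipProb, otherLabel]

/-- Properly 2-colour `T` and swap the labels on one colour class: separated edges become
unseparated and conversely. This involution pairs labellings with edge entropies adding up to `(n -
1) * h(δ)`, so one of each pair reaches half of that. Subtracting `h(δ)` leaves `(n - 3) / 2 *
h(δ)`. -/
theorem exists_bad_labellings {A : Type*} [Fintype A] {n : ℕ} (hn : 4 ≤ n) {δ ε : ℝ}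
    (h0 : 0 < δ) (h1 : δ < 1) {e : Bool → A} (he : Function.Injective e) (hε : 0 ≤ ε)
    (hlt : ε < (n - 3) / 2 * Real.binEntropy δ) {Θ : Finset (Fin n → Option Unit)}
    (hΘ : ∀ θ, θ ∈ Θ ↔ Function.Surjective θ) {T : SimpleGraph (Fin n)} (hT : T.IsTree) :
    ∃ B ⊆ Θ, (∀ θ ∈ B, ¬ IsApproxTree ε (model h0 h1 e θ) T) ∧ #Θ ≤ 2 * #B := by
  classical
  have hn' : (4 : ℝ) ≤ n := by exact_mod_cast hn
  have hh : 0 < Real.binEntropy δ := Real.binEntropy_pos h0 h1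
  let S : (Fin n → Option Unit) → ℝ := fun θ =>
    ∑ s ∈ T.edgeFinset, Real.binEntropy (edgeFlip δ θ s)
  let c := hT.coloringTwo
  let flip : (Fin n → Option Unit) → (Fin n → Option Unit) := fun θ i =>
    if c i = 0 then θ i else otherLabel (θ i)
  have hflip : ∀ θ, flip (flip θ) = θ := fun θ => funext fun i => by
    by_cases h : c i = 0 <;> simp [flip, h, otherLabel_otherLabel]
  have hS : ∀ θ, S θ + S (flip θ) = (n - 1) * Real.binEntropy δ := by
    intro θ
    have hcard : (#T.edgeFinset : ℝ) = n - 1 := by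
      have := hT.card_edgeFinset
      rw [Fintype.card_fin] at this
      rw [eq_sub_iff_add_eq]
      exact_mod_cast this
    rw [← hcard, ← nsmul_eq_mul, ← sum_const, ← sum_add_distrib]
    refine sum_congr rfl fun s hs => ?_
    induction s with
    | h i j =>
      have hij := c.valid (SimpleGraph.mem_edgeSet _ |>.1 (SimpleGraph.mem_edgeFinset.1 hs))
      rw [edgeFlip_mk, edgeFlip_mk]
      by_cases hi : c i = 0
      · have hj : c j ≠ 0 := fun h => hij (hi.trans h.symm)
        simp only [flip, hi, hj, if_true, if_false]
        exact binEntropy_flipProb_add _ _ _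
      · have hj : c j = 0 := by omega
        simp only [flip, hi, hj, if_true, if_false, flipProb_otherLabel]
        exact binEntropy_flipProb_add _ _ _
  let B := univ.filter fun θ => (n - 1) / 2 * Real.binEntropy δ ≤ S θ
  have hsurj : ∀ θ ∈ B, Function.Surjective θ := by
    intro θ hθ
    have hθ' : ((n : ℝ) - 1) / 2 * Real.binEntropy δ ≤ S θ := by simpa [B] using hθ
    -- A positive edge sum means that some edge is separated, so both labels occur.
    have hpos : 0 < S θ := lt_of_lt_of_le (mul_pos (by linarith) hh) hθ'
    obtain ⟨s, -, hs⟩ := exists_ne_zero_of_sum_ne_zero hpos.ne'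
    induction s with
    | h i j =>
      have hij : θ i ≠ θ j := fun h => hs (by simp [h])
      intro o
      have : ∀ u v o : Option Unit, u ≠ v → u = o ∨ v = o := by decide
      rcases this _ _ o hij with h | h
      exacts [⟨i, h⟩, ⟨j, h⟩]
  refine ⟨B, fun θ hθ => (hΘ θ).2 (hsurj θ hθ), fun θ hθ happ => ?_, ?_⟩
  · have h := happ.sum_binEntropy_le h0 h1 he (hsurj θ hθ) hε
    have hB : (n - 1) / 2 * Real.binEntropy δ ≤ S θ := by simpa [B] using hθ
    simp only [Fintype.card_unit, Nat.cast_one, one_mul] at h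
    change S θ - _ ≤ _ at h
    linarith
  · have hcover : (univ : Finset (Fin n → Option Unit)) ⊆ B ∪ B.image flip := by
      intro θ _
      rw [mem_union]
      by_cases hθ : θ ∈ B
      · exact Or.inl hθ
      · refine Or.inr (mem_image.2 ⟨flip θ, ?_, hflip θ⟩)
        have h2 := hS θ
        simp only [B, mem_filter, mem_univ, true_and, not_le] at hθ ⊢
        linarith
    calc #Θ ≤ #(univ : Finset (Fin n → Option Unit)) := card_le_card (subset_univ _)
      _ ≤ #(B ∪ B.image flip) := card_le_card hcover
      _ ≤ #B + #(B.image flip) := card_union_le _ _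
      _ ≤ 2 * #B := by have := card_image_le (s := B) (f := flip); omega

/-! ### Three hidden bits, and three variables -/

/-- The labelling in which `c` is the base bit and the others are its noisy copies. -/
def starLabel (c i : Fin 3) : Option Bool :=
  if i = c then none else some (decide (i = c + 1))

theorem starLabel_injective (c : Fin 3) : Function.Injective (starLabel c) := by
  revert c; decide

theorem starLabel_surjective (c : Fin 3) : Function.Surjective (starLabel c) := by
  revert c; unfold Function.Surjective; decide

theorem starLabel_injective_center : Function.Injective starLabel := by
  intro c c' h
  have := congrFun h c
  by_contra hne
  simp [starLabel, hne] at this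

theorem flipProb_starLabel (δ : ℝ) (c : Fin 3) :
    flipProb δ (starLabel c (c + 1)) (starLabel c (c + 2)) = 2 * δ * (1 - δ) := by
  fin_cases c <;> simp [flipProb, starLabel]

/-- A tree containing the edge between the two noisy copies pays `h(2δ(1 - δ))` for it and at least
`h(δ)` for its other edge, against an entropy of `2 h(δ)` in the star. The two edges of a tree on
three vertices are each opposite to a centre, so two centres are bad. -/
theorem exists_bad_stars {A : Type*} [Fintype A] {δ ε : ℝ}
    (h0 : 0 < δ) (h1 : δ < 1) (hδ : δ ≤ 1 / 2) {e : Bool → A} (he : Function.Injective e)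
    (hε : 0 ≤ ε) (hlt : ε < Real.binEntropy (2 * δ * (1 - δ)) - Real.binEntropy δ)
    {T : SimpleGraph (Fin 3)} (hT : T.IsTree) :
    ∃ B ⊆ univ.image starLabel, (∀ θ ∈ B, ¬ IsApproxTree ε (model h0 h1 e θ) T) ∧
      #(univ.image starLabel) ≤ 2 * #B := by
  classical
  let C : Finset (Fin 3) := univ.filter fun c => T.Adj (c + 1) (c + 2)
  refine ⟨C.image starLabel, image_subset_image (subset_univ _), fun θ hθ happ => ?_, ?_⟩
  · obtain ⟨c, hc, rfl⟩ := mem_image.1 hθ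
    have hadj : T.Adj (c + 1) (c + 2) := by simpa [C] using hc
    have h := happ.sum_binEntropy_le h0 h1 he (starLabel_surjective c) hε
    have hmem : s(c + 1, c + 2) ∈ T.edgeFinset := by simpa using hadj
    rw [← add_sum_erase _ _ hmem, edgeFlip_mk, flipProb_starLabel] at h
    have hcard : #(T.edgeFinset.erase s(c + 1, c + 2)) = 1 := by
      have := hT.card_edgeFinset
      rw [card_erase_of_mem hmem]
      rw [Fintype.card_fin] at this
      omega
    obtain ⟨s, hs⟩ := card_eq_one.1 hcard
    have hsT : s ∈ T.edgeFinset := mem_of_mem_erase (hs ▸ mem_singleton_self s)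
    -- The labels are distinct, so the flip probability is `δ` or `2δ(1 - δ)`; as `δ ≤ 1/2`, both
    -- lie in `[δ, 1/2]`, where the entropy is increasing.
    have hs' : Real.binEntropy δ ≤ Real.binEntropy (edgeFlip δ (starLabel c) s) := by
      induction s with
      | h i j =>
        have hij : i ≠ j := (SimpleGraph.mem_edgeSet _ |>.1 (SimpleGraph.mem_edgeFinset.1 hsT)).ne
        rw [edgeFlip_mk, flipProb, if_neg ((starLabel_injective c).ne hij)]
        split_ifs
        · exact le_rfl
        · refine Real.binEntropy_strictMonoOn.monotoneOn ?_ ?_ ?_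
          · constructor <;> linarith
          · constructor
            · nlinarith
            · nlinarith [sq_nonneg (δ - 1 / 2)]
          · nlinarith
    rw [hs, sum_singleton] at h
    simp only [Fintype.card_bool, Nat.cast_ofNat] at h
    linarith
  · rw [card_image_of_injective _ starLabel_injective_center,
      card_image_of_injective _ starLabel_injective_center, card_univ, Fintype.card_fin]
    have hnbr : ∀ v, ∃ w, T.Adj v w := fun v =>
      hT.connected.preconnected.exists_adj_of_nontrivial v
    have hmem : ∀ v w, T.Adj v w → ∀ c, c ≠ v → c ≠ w → c ∈ C := by
      intro v w hvw c hv hw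
      have hne := hvw.ne
      have : (c + 1 = v ∧ c + 2 = w) ∨ (c + 1 = w ∧ c + 2 = v) := by
        clear hvw; revert v w c; decide
      rcases this with ⟨h1, h2⟩ | ⟨h1, h2⟩
      · simpa [C, h1, h2] using hvw
      · simpa [C, h1, h2] using hvw.symm
    have h2 : 1 < #C := by
      obtain ⟨w, hw⟩ := hnbr 0
      obtain ⟨c, hc0, hcw⟩ : ∃ c : Fin 3, c ≠ 0 ∧ c ≠ w := by
        clear hw; revert w; decide
      obtain ⟨w', hw'⟩ := hnbr c
      obtain ⟨c', hc'c, hc'w⟩ : ∃ c' : Fin 3, c' ≠ c ∧ c' ≠ w' := by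
        clear hw hw' hcw hc0; revert c w'; decide
      exact one_lt_card.2 ⟨c, hmem 0 w hw c hc0 hcw, c', hmem c w' hw' c' hc'c hc'w, hc'c.symm⟩
    omega

/-! ### Entropy estimates -/

theorem mul_log_inv_le_binEntropy {p : ℝ} (h0 : 0 ≤ p) (h1 : p < 1) :
    p * Real.log p⁻¹ ≤ Real.binEntropy p := by
  rw [Real.binEntropy]
  have : 0 ≤ Real.log (1 - p)⁻¹ :=
    Real.log_nonneg (one_le_inv_iff₀.2 ⟨by linarith, by linarith⟩)
  nlinarith

theorem binEntropy_le_mul_log_inv_add {p : ℝ} (h1 : p < 1) :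
    Real.binEntropy p ≤ p * Real.log p⁻¹ + p := by
  rw [Real.binEntropy]
  have hp : 0 < 1 - p := by linarith
  have := mul_le_mul_of_nonneg_left (Real.log_le_sub_one_of_pos (inv_pos.2 hp)) hp.le
  rw [mul_sub, mul_inv_cancel₀ hp.ne'] at this
  linarith

/-- With `L = log (1/δ)`, the difference is at least `3/2 * δ * (L - 1) - δ * L - δ = δ * (L - 5) /
2`, which is at least `3/16 * δ * L` exactly when `L ≥ 8`. The factor `3/16` is `n/16` at `n = 3`.
-/
theorem binEntropy_two_mul_sub_ge {δ : ℝ} (h0 : 0 < δ) (h1 : δ ≤ 1 / 4)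
    (hL : 8 ≤ Real.log δ⁻¹) :
    3 / 16 * (δ * Real.log δ⁻¹) ≤ Real.binEntropy (2 * δ * (1 - δ)) - Real.binEntropy δ := by
  set s := 2 * δ * (1 - δ) with hs
  have hs_ge : 3 / 2 * δ ≤ s := by nlinarith
  have hs_le : s ≤ 2 * δ := by nlinarith
  have hs0 : 0 < s := by linarith
  have h2 := mul_log_inv_le_binEntropy hs0.le (by linarith : s < 1)
  have h3 := binEntropy_le_mul_log_inv_add (by linarith : δ < 1)
  have hlog : Real.log δ⁻¹ - 1 ≤ Real.log s⁻¹ := by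
    have := Real.log_le_log hs0 hs_le
    rw [Real.log_mul (by norm_num) h0.ne'] at this
    have := Real.log_two_lt_d9
    rw [Real.log_inv, Real.log_inv]
    linarith
  have h4 : 3 / 2 * δ * (Real.log δ⁻¹ - 1) ≤ s * Real.log s⁻¹ :=
    mul_le_mul hs_ge hlog (by linarith) hs0.le
  nlinarith

/-- The choice of the noise level. -/
theorem exists_noise_level {y : ℝ} (hy : 1000000 ≤ y) :
    0 < Real.log y ∧ 64 / (y * Real.log y) ≤ 1 / 4 ∧
      8 ≤ Real.log (64 / (y * Real.log y))⁻¹ ∧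
      32 / y ≤ 64 / (y * Real.log y) * Real.log (64 / (y * Real.log y))⁻¹ := by
  -- `15625 = 1000000 / 64`, a lower bound for `1/δ`.
  have he : Real.exp 8 ≤ 15625 := by
    calc Real.exp 8 = Real.exp 1 ^ 8 := by rw [← Real.exp_nat_mul]; norm_num
      _ ≤ 3 ^ 8 := by gcongr; exact Real.exp_one_lt_three.le
      _ ≤ 15625 := by norm_num
  have hy0 : 0 < y := by linarith
  have hl : 8 ≤ Real.log y := (Real.le_log_iff_exp_le hy0).2 (by linarith)
  have hyl : 1000000 ≤ y * Real.log y := by nlinarith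
  have hyl0 : 0 < y * Real.log y := by linarith
  have hL : 8 ≤ Real.log (64 / (y * Real.log y))⁻¹ := by
    rw [Real.le_log_iff_exp_le (by positivity), inv_div]
    linarith
  refine ⟨by linarith, ?_, hL, ?_⟩
  · rw [div_le_iff₀ hyl0]; linarith
  · have h2 : Real.log y ≤ 2 * Real.log (64 / (y * Real.log y))⁻¹ := by
      rw [inv_div, ← Real.log_rpow (by positivity)]
      refine Real.log_le_log hy0 ?_
      rw [Real.rpow_two, div_pow, le_div_iff₀ (by norm_num), mul_pow]
      nlinarith
    rw [div_mul_eq_mul_div, div_le_div_iff₀ hy0 hyl0]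
    nlinarith

end TreeLearning

/-! ### Choice of constants and conclusion -/

theorem theorem7p6 :
    ∃ c : ℝ, 0 < c ∧ ∃ η : ℝ, 0 < η ∧
      ∀ (A : Type*) [Fintype A] [Nontrivial A] (n : ℕ), 3 ≤ n →
        ∀ ε : ℝ, 0 < ε → ε ≤ η * n →
          ∀ (N : ℕ) (alg : TreeLearning.TreeAlgorithm A n N),
            (∀ P : PMF (Fin n → A), TreeLearning.IsTreeStructured P →
              TreeLearning.errorProb alg ε P < 1 / 3) →
            c * (n / ε) * Real.log (n / ε) ≤ N := by
  classical
  -- Both families have `|K| ≤ 2`, so `2 * N * δ ≥ 1/3` with `δ = 64 / (y log y)` gives `N ≥ y log y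
  -- / 384`. The value of `η` gives `y ≥ 1000000`.
  refine ⟨1 / 384, by norm_num, 1 / 1000000, by norm_num, ?_⟩
  intro A _ _ n hn ε hε hεn N alg herr
  have hn0 : (3 : ℝ) ≤ n := by exact_mod_cast hn
  have hy : 1000000 ≤ (n : ℝ) / ε := by rw [le_div_iff₀ hε]; linarith
  obtain ⟨hl, hδ4, hL, hδL⟩ := TreeLearning.exists_noise_level hy
  set y : ℝ := n / ε with hydef
  have hyl0 : 0 < y * Real.log y := mul_pos (by linarith) hl
  set δ : ℝ := 64 / (y * Real.log y) with hδ
  have h0 : 0 < δ := by positivity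
  have h1 : δ < 1 := by linarith
  -- The choice of `δ` gives `n * δ * log (1/δ) ≥ 32 * ε`, so the right side is at least `2 * ε`.
  have hgap : ε < n / 16 * (δ * Real.log δ⁻¹) := by
    have h32 : (32 : ℝ) / y = 32 * ε / n := by rw [hydef]; field_simp
    rw [h32, div_le_iff₀ (by linarith)] at hδL
    linarith
  obtain ⟨a, b, hab⟩ := exists_pair_ne A
  have he : Function.Injective fun t : Bool => if t then b else a := by
    intro s t h; cases s <;> cases t <;> simp_all
  suffices h : 1 / 3 ≤ 2 * N * δ by
    rw [hδ, mul_div_assoc', le_div_iff₀ hyl0] at h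
    linarith
  rcases hn.eq_or_lt with rfl | hn4
  · have hlt := TreeLearning.binEntropy_two_mul_sub_ge h0 hδ4 hL
    refine le_of_le_of_eq (TreeLearning.card_mul_samples_ge alg h0 h1 he
      (Θ := Finset.univ.image TreeLearning.starLabel) (Finset.univ_nonempty.image _) ?_
      (fun T hT => TreeLearning.exists_bad_stars h0 h1 (by linarith) he hε.le ?_ hT) herr)
      (by simp)
    · intro θ hθ
      obtain ⟨c, -, rfl⟩ := Finset.mem_image.1 hθ
      exact TreeLearning.starLabel_surjective c
    · push_cast at hgap
      linarith
  · have hn4' : (4 : ℝ) ≤ n := by exact_mod_cast hn4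
    have hent := TreeLearning.mul_log_inv_le_binEntropy h0.le h1
    have hpos : 0 ≤ δ * Real.log δ⁻¹ := by positivity
    refine (TreeLearning.card_mul_samples_ge alg h0 h1 he
      (Θ := Finset.univ.filter fun θ : Fin n → Option Unit => Function.Surjective θ) ?_ ?_
      (fun T hT => TreeLearning.exists_bad_labellings hn4 h0 h1 he hε.le ?_ (by simp) hT)
      herr).trans ?_
    · have : 1 < n := by omega
      refine ⟨fun i => if i = ⟨0, by omega⟩ then none else some (), ?_⟩
      rw [Finset.mem_filter]
      refine ⟨Finset.mem_univ _, fun o => ?_⟩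
      cases o with
      | none => exact ⟨⟨0, by omega⟩, by simp⟩
      | some u => exact ⟨⟨1, this⟩, by simp⟩
    · intro θ hθ
      simpa using hθ
    -- For `n ≥ 4`, `n / 16 ≤ (n - 3) / 2`.
    · calc ε < n / 16 * (δ * Real.log δ⁻¹) := hgap
        _ ≤ (n - 3) / 2 * (δ * Real.log δ⁻¹) :=
          mul_le_mul_of_nonneg_right (by linarith) hpos
        _ ≤ (n - 3) / 2 * Real.binEntropy δ :=
          mul_le_mul_of_nonneg_left hent (by linarith)
    · have : 0 ≤ (N : ℝ) * δ := by positivity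
      simp only [Fintype.card_unit, Nat.cast_one, one_mul]
      linarith
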